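/- Let $\alpha,\kappa,\lambda\in\mathbb{R}$ with $\alpha\neq 0$, $\kappa\neq 0$ and $\alpha\neq-\kappa(\kappa-1)$, and consider the HSA dynamo with $\beta=0$, \[ \dot x=x(y-1),\qquad \dot y=\alpha(1-x^2)-\kappa y,\qquad \dot z=x-\lambda z, \] with associated vector field $\mathfrak X=x(y-1)\partial_x+(\alpha(1-x^2)-\kappa y)\partial_y+(x-\lambda z)\partial_z$. A first integral on an open set $U\subseteq\mathbb{R}^3$ is a nonconstant (real- or complex-valued) function on $U$ that is constant along every solution as long as the solution stays in $U$. A Darboux polynomial is a nonconstant $h\in\mathbb{C}[x,y,z]$ with $\mathfrak X h=Kh$ for some $K\in\mathbb{C}[x,y,z]$, its cofactor. An exponential factor is a nonconstant function $e^{g/h}$, with $g,h\in\mathbb{C}[x,y,z]$ coprime and $h\ne0$, such that $\mathfrak X e^{g/h}=Le^{g/h}$ for some $L\in\mathbb{C}[x,y,z]$ of degree at most $1$, its cofactor. The system is Darboux integrable if, on some connected open set $U\subseteq\mathbb{R}^3$, it has a first integral of the form \[ f_1^{\lambda_1}\cdots f_p^{\lambda_p}\,\bigl[e^{g_1/h_1}\bigr]^{\mu_1}\cdots\bigl[e^{g_q/h_q}\bigr]^{\mu_q},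 \] where the $f_j$ are Darboux polynomials, the $e^{g_k/h_k}$ are exponential factors, $\lambda_j,\mu_k\in\mathbb{C}$, and $f_j^{\lambda_j}=e^{\lambda_j\ell_j}$ for a continuous branch $\ell_j$ of $\log f_j$ on $U$. Then: (a) The system has no polynomial first integral. (b) Up to constant multiples and powers, $x$ is its only Darboux polynomial with nonzero cofactor: the Darboux polynomials with nonzero cofactor are exactly the polynomials $c\,x^n$ with $c\in\mathbb{C}\setminus\{0\}$ and $n\ge1$, and the cofactor of $c\,x^n$ is $n(y-1)$. (c) Up to constant multiples and powers, $e^{z}$ is its only exponential factor, with cofactor $x-\lambda z$: the exponential factors are exactly the functions $e^{cz+d}$ with $c\in\mathbb{C}\setminus\{0\}$ and $d\in\mathbb{C}$, and the cofactor of $e^{cz+d}$ is $c(x-\lambda z)$. (d) The system is not Darboux integrable. -/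

import Mathlib

namespace HSA

noncomputable section

/-- The ring `ℂ[x, y, z]`. -/
abbrev Poly : Type := MvPolynomial (Fin 3) ℂ

/-- The coordinate polynomial `x`. -/
def x : Poly := MvPolynomial.X 0

/-- The coordinate polynomial `y`. -/
def y : Poly := MvPolynomial.X 1

/-- The coordinate polynomial `z`. -/
def z : Poly := MvPolynomial.X 2

/-- A complex number as a constant polynomial. -/
abbrev const (c : ℂ) : Poly := MvPolynomial.C c

/-- The vector field of the HSA dynamo
`x' = x (y - 1) - β z`, `y' = α (1 - x ^ 2) - κ y`, `z' = x - lam z`,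
as a derivation of `ℂ[x, y, z]`. -/
def field (α β κ lam : ℝ) : Derivation ℂ Poly Poly :=
  MvPolynomial.mkDerivation ℂ
    ![x * (y - 1) - const β * z, const α * (1 - x ^ 2) - const κ * y, x - const lam * z]

/-- The value of a complex polynomial at a point of `ℝ³`. -/
def evalAt (f : Poly) (P : Fin 3 → ℝ) : ℂ :=
  MvPolynomial.eval (fun i => (P i : ℂ)) f

/-- `γ` is a solution of the HSA dynamo on the open time interval `(a, b)`. -/
def IsSolutionOn (α β κ lam : ℝ) (γ : ℝ → Fin 3 → ℝ) (a b : ℝ) : Prop :=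
  ∀ t ∈ Set.Ioo a b,
    HasDerivAt (fun s => γ s 0) (γ t 0 * (γ t 1 - 1) - β * γ t 2) t ∧
    HasDerivAt (fun s => γ s 1) (α * (1 - (γ t 0) ^ 2) - κ * γ t 1) t ∧
    HasDerivAt (fun s => γ s 2) (γ t 0 - lam * γ t 2) t

/-- `H` is a (real- or complex-valued) first integral on the open set `U ⊆ ℝ³`: it is
nonconstant on `U`, and constant along every solution as long as this stays in `U`. -/
structure IsFirstIntegralOn (α β κ lam : ℝ) (U : Set (Fin 3 → ℝ)) (H : (Fin 3 → ℝ) → ℂ) :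
    Prop where
  isOpen : IsOpen U
  nonconstant : ∃ P ∈ U, ∃ Q ∈ U, H P ≠ H Q
  constant_along : ∀ (γ : ℝ → Fin 3 → ℝ) (a b : ℝ), IsSolutionOn α β κ lam γ a b →
    (∀ t ∈ Set.Ioo a b, γ t ∈ U) →
    ∀ s ∈ Set.Ioo a b, ∀ t ∈ Set.Ioo a b, H (γ s) = H (γ t)

/-- The HSA dynamo has a polynomial first integral (complex coefficients are allowed, and the
polynomial may be a first integral on some open set only). -/
def HasPolynomialFirstIntegral (α β κ lam : ℝ) : Prop :=
  ∃ (h : Poly) (U : Set (Fin 3 → ℝ)), IsFirstIntegralOn α β κ lam U (evalAt h)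

/-- `h` is a Darboux polynomial with cofactor `K`. -/
structure IsDarbouxPolynomial (α β κ lam : ℝ) (h K : Poly) : Prop where
  nonconstant : ∀ c : ℂ, h ≠ const c
  eq : field α β κ lam h = K * h

/-- `exp (g / h)` is an exponential factor with cofactor `L`: here `g` and `h` are coprime
(have no common factor), `g / h` is not constant, `L` has degree at most one, and
`𝔛 (g / h) = L`, with the denominator `h ^ 2` of the quotient rule cleared. -/
structure IsExponentialFactor (α β κ lam : ℝ) (g h L : Poly) : Prop where
  denom_ne_zero : h ≠ 0
  coprime : IsRelPrime g h
  nonconstant : ∀ c : ℂ, g ≠ const c * h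
  degree_le : L.totalDegree ≤ 1
  eq : h * field α β κ lam g - g * field α β κ lam h = L * h ^ 2

/-- On `U`, the function `G` has the form
`f₁ ^ a₁ ⋯ f_p ^ a_p * (exp (g₁ / h₁)) ^ μ₁ ⋯ (exp (g_q / h_q)) ^ μ_q`
with Darboux polynomials `f_j`, exponential factors `exp (g_k / h_k)` and complex exponents.
The power `f_j ^ a_j` is `exp (a_j * ℓ_j)` for a continuous branch `ℓ_j` of `log f_j` on `U`. -/
def IsDarbouxFunctionOn (α β κ lam : ℝ) (U : Set (Fin 3 → ℝ)) (G : (Fin 3 → ℝ) → ℂ) : Prop :=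
  ∃ (p q : ℕ) (f : Fin p → Poly) (a : Fin p → ℂ) (ℓ : Fin p → (Fin 3 → ℝ) → ℂ)
    (g h : Fin q → Poly) (μ : Fin q → ℂ),
    (∀ j, ∃ K, IsDarbouxPolynomial α β κ lam (f j) K) ∧
    (∀ k, ∃ L, IsExponentialFactor α β κ lam (g k) (h k) L) ∧
    (∀ j, ContinuousOn (ℓ j) U ∧ ∀ P ∈ U, Complex.exp (ℓ j P) = evalAt (f j) P) ∧
    (∀ k, ∀ P ∈ U, evalAt (h k) P ≠ 0) ∧
    ∀ P ∈ U, G P = (∏ j, Complex.exp (a j * ℓ j P)) *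
      ∏ k, Complex.exp (μ k * (evalAt (g k) P / evalAt (h k) P))

/-- The HSA dynamo is Darboux integrable: some function of Darboux type is a first integral on
a connected open set. (On a disconnected set, different branches of the powers on different
components would make locally constant functions such as `x ^ a * x ^ (-a)` nonconstant.) -/
def IsDarbouxIntegrable (α β κ lam : ℝ) : Prop :=
  ∃ (U : Set (Fin 3 → ℝ)) (G : (Fin 3 → ℝ) → ℂ), IsPreconnected U ∧
    IsDarbouxFunctionOn α β κ lam U G ∧ IsFirstIntegralOn α β κ lam U G

end

end HSA

namespace HSA

open MvPolynomial

/-! Everything reduces to one question: which polynomials `h` satisfy `𝔛 h = c h + L` with `c`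
constant and `L` affine, where `c = 0` or `L = 0`? The answer (`eq_linear_of_field_eq`) is `h = a z
+ b`. Sorting by powers of `z`, each coefficient of `h` solves a planar equation in `x, y` whose
source comes from the next higher coefficient.

For the planar equation (`IsPlanarArray.eq_zero_of_planarField`), odd powers of `x` vanish row by
row. In the even part, the top form must be a multiple of `(y² + α x²)^(N/2)`; the coefficient of
`y^N` then forces the constant cofactor to be `-κ N`, and the next lower form forces `α = κ (1 -
κ)`, the excluded value. So only constants survive.

For a general cofactor, which is affine for degree reasons, the symmetry `(x, y, z) ↦ (-x, y, -z)`
makes the cofactor of `h * reflect h` free of `x` and `z`. Dividing out the powers of `x` removes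
the `y` term as well (`cofactor_y_eq_zero`), so `h * reflect h` is a monomial in `x`, and hence so
is `h`. Coprimality then forces the denominator of an exponential factor to be constant.

A Darboux function is therefore `exp (A log |x| + B z + D)` on a connected set. Constancy along
solutions gives `A (y - 1) + B (x - lam z) = 0`, so `A = B = 0` and the function is constant. -/

/-! ### The planar equation on coefficient arrays -/

/-- An integer-indexed array supported on finitely many pairs of natural numbers. -/
structure IsPlanarArray (w : ℤ → ℤ → ℂ) : Prop where
  neg_left : ∀ i j, i < 0 → w i j = 0
  neg_right : ∀ i j, j < 0 → w i j = 0
  bounded : ∃ M : ℤ, ∀ i j, M < i + j → w i j = 0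

/-- The planar field `x (y - 1) ∂x + (α (1 - x ^ 2) - κ y) ∂y` on arrays of coefficients. -/
def planarField (α κ : ℂ) (w : ℤ → ℤ → ℂ) (i j : ℤ) : ℂ :=
  i * (w i (j - 1) - w i j) + α * (j + 1) * (w i (j + 1) - w (i - 2) (j + 1)) - κ * j * w i j

variable {α κ k : ℂ} {w r : ℤ → ℤ → ℂ}

/-- The term `x y ∂x` raises the `y`-degree of a row, and only row `i - 2` could compensate. -/
lemma IsPlanarArray.row_eq_zero (hw : IsPlanarArray w) {i : ℤ} (hi : i ≠ 0)
    (h2 : ∀ j, w (i - 2) j = 0)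
    (hE : ∀ j, 1 ≤ j → planarField α κ w i j = k * w i j) (j : ℤ) : w i j = 0 := by
  by_contra hj
  obtain ⟨M, hM⟩ := hw.bounded
  obtain ⟨J, hJ, hmax⟩ := Int.exists_greatest_of_bdd (P := fun j => w i j ≠ 0)
    ⟨M - i, fun j hj => by by_contra h; exact hj (hM _ _ (by omega))⟩ ⟨j, hj⟩
  have hJ0 : 0 ≤ J := by by_contra h; exact hJ (hw.neg_right _ _ (by omega))
  have hz : ∀ j, J < j → w i j = 0 := fun j hj => by
    by_contra h; have := hmax j h; omega
  -- One step above the top entry of the row, only `i * w i J` is left.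
  have := hE (J + 1) (by omega)
  rw [planarField, hz (J + 1) (by omega), hz (J + 1 + 1) (by omega), h2, add_sub_cancel_right] at this
  have hi' : (i : ℂ) ≠ 0 := by exact_mod_cast hi
  simp [hi', hJ] at this

lemma IsPlanarArray.odd_row_eq_zero (hw : IsPlanarArray w)
    (hE : ∀ i j, planarField α κ w i j = k * w i j + r i j)
    (hr : ∀ i j, Odd i → 1 ≤ j → r i j = 0) {i : ℤ} (hi : Odd i) (j : ℤ) : w i j = 0 := by
  -- The induction over odd rows starts at row `-1`, which is empty.
  have key : ∀ n : ℕ, ∀ j, w (2 * n - 1) j = 0 := by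
    intro n
    induction n with
    | zero => exact fun j => hw.neg_left _ _ (by simp)
    | succ n ih =>
      refine hw.row_eq_zero (α := α) (κ := κ) (k := k) (by omega) (fun j => ?_) (fun j hj => ?_)
      · rw [← ih j]; congr 1; push_cast; ring
      · rw [hE, hr _ _ ⟨n, by push_cast; ring⟩ hj, add_zero]
  rcases lt_or_ge i 0 with h | h
  · exact hw.neg_left _ _ h
  · obtain ⟨m, rfl⟩ := hi
    have := key (m + 1).toNat j
    rwa [show (2 * ((m + 1).toNat : ℤ) - 1) = 2 * m + 1 by omega] at this

/-- Once the odd rows are gone, the equation there reads `0 = r`. The gain is the column `j = 0`,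
which the hypothesis leaves open; it later excludes a source proportional to `x`. -/
lemma IsPlanarArray.odd_source_eq_zero (hw : IsPlanarArray w)
    (hE : ∀ i j, planarField α κ w i j = k * w i j + r i j)
    (hr : ∀ i j, Odd i → 1 ≤ j → r i j = 0) {i : ℤ} (hi : Odd i) (j : ℤ) : r i j = 0 := by
  have h0 := fun j => hw.odd_row_eq_zero hE hr hi j
  have h2 := fun j => hw.odd_row_eq_zero hE hr (i := i - 2) (by obtain ⟨m, rfl⟩ := hi; exact ⟨m - 1, by ring⟩) j
  have := hE i j
  simpa [planarField, h0, h2] using this.symm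

/-- A recursion with nonzero coefficients cannot terminate. -/
lemma eq_zero_of_recursion {d c c' : ℕ → ℂ} (hc : ∀ n, c' n ≠ 0)
    (hd : ∀ n, c n * d (n + 1) = c' n * d n) (hfin : ∃ n, d n = 0) : d 0 = 0 := by
  by_contra h0
  have : ∀ n, d n ≠ 0 := by
    intro n
    induction n with
    | zero => exact h0
    | succ n ih =>
      intro h
      have := hd n
      rw [h, mul_zero] at this
      exact mul_ne_zero (hc n) ih this.symm
  obtain ⟨n, hn⟩ := hfin
  exact this n hn

/-- Off the special parameter, the planar field has no nonconstant polynomial solution with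
constant cofactor, even with a source of low degree. -/
lemma IsPlanarArray.eq_zero_of_planarField (hw : IsPlanarArray w) (hα : α ≠ 0) (hκ : κ ≠ 0)
    (hακ : α ≠ κ * (1 - κ))
    (hE : ∀ i j, planarField α κ w i j = k * w i j + r i j)
    (hr : ∀ i j, (i, j) ≠ (0, 0) → (i, j) ≠ (0, 1) → (Odd i → 1 ≤ j) → r i j = 0)
    (hk : k ≠ 0 → r 0 1 = 0) {i j : ℤ} (hij : (i, j) ≠ (0, 0)) : w i j = 0 := by
  by_contra hne
  have hi_nonneg : 0 ≤ i := by by_contra h; exact hne (hw.neg_left _ _ (by omega))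
  have hj_nonneg : 0 ≤ j := by by_contra h; exact hne (hw.neg_right _ _ (by omega))
  have hr' : ∀ i j, Odd i → 1 ≤ j → r i j = 0 := fun i j hi hj => by
    obtain ⟨m, rfl⟩ := hi
    exact hr _ _ (by simp; omega) (by simp; omega) fun _ => hj
  have hi_even : Even i := by
    by_contra h
    exact hne (hw.odd_row_eq_zero hE hr' (Int.not_even_iff_odd.mp h) j)
  obtain ⟨M, hM⟩ := hw.bounded
  obtain ⟨N, ⟨i₀, j₀, he₀, hN₀, hw₀⟩, hmax⟩ := Int.exists_greatest_of_bdd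
    (P := fun N => ∃ i j, Even i ∧ i + j = N ∧ w i j ≠ 0)
    ⟨M, by rintro _ ⟨i, j, -, rfl, h⟩; by_contra h'; exact h (hM _ _ (by omega))⟩
    ⟨i + j, i, j, hi_even, rfl, hne⟩
  have hN1 : 1 ≤ N := by
    have := hmax (i + j) ⟨i, j, hi_even, rfl, hne⟩
    by_contra h
    exact hij (by rw [Prod.mk.injEq]; omega)
  have hz : ∀ i j, Even i → N < i + j → w i j = 0 := fun i j hi hj => by
    by_contra h; have := hmax _ ⟨i, j, hi, rfl, h⟩; omega
  have hr_even : ∀ i j, Even i → (i, j) ≠ (0, 0) → (i, j) ≠ (0, 1) → r i j = 0 :=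
    fun i j he h1 h2 => hr i j h1 h2 fun ho => absurd ho (Int.not_odd_iff_even.mpr he)
  -- The top form of the even part. The equation in degree `N + 1` gives it the recursion of the
  -- coefficients of `(y² + α x²)^(N/2)`.
  set b : ℕ → ℂ := fun n => w (2 * n) (N - 2 * n) with hb
  have hb_rec : ∀ n : ℕ, (2 * (n + 1) : ℂ) * b (n + 1) = (α * (N - 2 * n)) * b n := by
    intro n
    have := hE (2 * (n + 1)) (N - 2 * n - 1)
    rw [hr_even _ _ (even_two_mul _) (by simp; omega) (by simp; omega), planarField,
      hz _ (N - 2 * n - 1) (even_two_mul _) (by omega),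
      hz _ (N - 2 * n - 1 + 1) (even_two_mul _) (by omega)] at this
    simp only [hb]
    push_cast at this ⊢
    rw [show (2 * (n + 1) - 2 : ℤ) = 2 * n by ring, show N - 2 * (n : ℤ) - 1 + 1 = N - 2 * n by ring,
      show N - 2 * (n : ℤ) - 1 - 1 = N - 2 * (n + 1) by ring] at this
    linear_combination this
  have hb_fin : ∃ n, b n = 0 := ⟨(N + 1).toNat, hw.neg_right _ _ (by omega)⟩
  have hb0 : b 0 ≠ 0 := by
    intro h0
    have : ∀ n, b n = 0 := by
      intro n
      induction n with
      | zero => exact h0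
      | succ n ih =>
        have := hb_rec n
        rw [ih, mul_zero] at this
        have h2 : (2 * (n + 1) : ℂ) ≠ 0 := by exact_mod_cast (by omega : 2 * (n + 1) ≠ 0)
        exact (mul_eq_zero.mp this).resolve_left h2
    have hi₀ : 0 ≤ i₀ := by by_contra h; exact hw₀ (hw.neg_left _ _ (by omega))
    obtain ⟨m, rfl⟩ := he₀
    apply hw₀
    rw [← this m.toNat, hb]
    dsimp only
    congr 1 <;> omega
  -- For odd `N` the factor `N - 2 n` never vanishes, so the recursion could not stop.
  have hN_even : Even N := by
    by_contra ho
    rw [Int.not_even_iff_odd] at ho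
    refine hb0 (eq_zero_of_recursion (fun n => mul_ne_zero hα ?_) hb_rec hb_fin)
    obtain ⟨m, rfl⟩ := ho
    exact_mod_cast (by omega : 2 * m + 1 - 2 * (n : ℤ) ≠ 0)
  obtain ⟨m, hm⟩ := hN_even
  -- Read off at `y^N`, where only the damping `-κ y ∂y` contributes.
  have hkN : k = -κ * N := by
    have := hE 0 N
    rw [hr_even _ _ Even.zero (by simp; omega) (by simp; omega), planarField,
      hz _ (N + 1) Even.zero (by omega), hw.neg_left (0 - 2) _ (by omega)] at this
    have hb0' : w 0 N ≠ 0 := by simpa [hb] using hb0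
    apply mul_right_cancel₀ hb0'
    push_cast at this
    linear_combination -this
  have hN0 : (N : ℂ) ≠ 0 := by exact_mod_cast (by omega : N ≠ 0)
  have hk0 : k ≠ 0 := by rw [hkN]; exact mul_ne_zero (neg_ne_zero.mpr hκ) hN0
  -- The form of degree `N - 1`, driven by the top form.
  set e : ℕ → ℂ := fun n => w (2 * n) (N - 1 - 2 * n) with he
  have he_rec : ∀ n : ℕ, (2 * (n + 1) : ℂ) * e (n + 1) =
      α * (N - 1 - 2 * n) * e n + (1 - κ) * (α * (N - 2 * n)) * b n := by
    intro n
    have h1 := hb_rec n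
    have := hE (2 * (n + 1)) (N - 2 * n - 2)
    rw [hr_even _ _ (even_two_mul _) (by simp; omega) (by simp; omega), planarField,
      hz _ (N - 2 * n - 2 + 1) (even_two_mul _) (by omega), hkN] at this
    simp only [hb, he] at h1 ⊢
    push_cast at this h1 ⊢
    rw [show (2 * (n + 1) - 2 : ℤ) = 2 * n by ring,
      show N - 2 * (n : ℤ) - 2 + 1 = N - 1 - 2 * n by ring,
      show N - 2 * (n : ℤ) - 2 - 1 = N - 1 - 2 * (n + 1) by ring,
      show N - 2 * (n : ℤ) - 2 = N - 2 * (n + 1) by ring] at this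
    linear_combination this + (1 - κ) * h1
  -- Adding `(1 - κ) (N - 2 n) b n`, a particular solution up to sign, makes the recursion
  -- homogeneous. Its factor `N - 1 - 2 n` is odd, hence nonzero, so termination kills the sequence.
  have hd0 : e 0 + (1 - κ) * (N - 2 * (0 : ℕ)) * b 0 = 0 := by
    refine eq_zero_of_recursion (d := fun n => e n + (1 - κ) * (N - 2 * n) * b n)
      (c := fun n => 2 * (n + 1)) (c' := fun n => α * (N - 1 - 2 * n)) (fun n => ?_) (fun n => ?_)
      ⟨(N + 1).toNat, ?_⟩
    · refine mul_ne_zero hα ?_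
      exact_mod_cast (by omega : N - 1 - 2 * (n : ℤ) ≠ 0)
    · push_cast
      linear_combination he_rec n + (1 - κ) * (N - 2 * (n + 1)) * hb_rec n
    · simp only [hb, he]
      rw [hw.neg_right _ _ (by omega), hw.neg_right _ _ (by omega)]
      simp
  have hlast := hE 0 (N - 1)
  -- The source can interfere at `y` only for `N = 2`; there `k ≠ 0` rules it out.
  have hr0 : r 0 (N - 1) = 0 := by
    by_cases h : N - 1 = 1
    · rw [h]; exact hk hk0
    · exact hr_even _ _ Even.zero (by simp; omega) (by simpa using h)
  rw [hr0, planarField, hw.neg_left (0 - 2) _ (by omega), hkN, sub_add_cancel] at hlast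
  simp only [hb, he, Nat.cast_zero, mul_zero, sub_zero] at hd0 hb0
  -- The coefficient of `y^(N-1)` gives `α N b 0 + κ e 0 = 0`, and `e 0 = -(1 - κ) N b 0`.
  apply hακ
  apply mul_right_cancel₀ (mul_ne_zero hN0 hb0)
  push_cast at hlast
  linear_combination hlast - κ * hd0

/-! ### Coefficients with integer exponents, and the field in terms of them -/

/-- The exponent of `x ^ i * y ^ j * z ^ k`. -/
noncomputable def expo (i j k : ℕ) : Fin 3 →₀ ℕ :=
  Finsupp.single 0 i + Finsupp.single 1 j + Finsupp.single 2 k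

/-- The coefficient of `x ^ i * y ^ j * z ^ k`, extended by zero to integer exponents. -/
noncomputable def intCoeff (p : Poly) (i j k : ℤ) : ℂ :=
  if 0 ≤ i ∧ 0 ≤ j ∧ 0 ≤ k then coeff (expo i.toNat j.toNat k.toNat) p else 0

lemma intCoeff_natCast (p : Poly) (i j k : ℕ) : intCoeff p i j k = coeff (expo i j k) p := by
  simp [intCoeff]

lemma intCoeff_of_neg {p : Poly} {i j k : ℤ} (h : i < 0 ∨ j < 0 ∨ k < 0) :
    intCoeff p i j k = 0 := if_neg (by omega)

lemma expo_apply (m : Fin 3 →₀ ℕ) : expo (m 0) (m 1) (m 2) = m := by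
  ext i; fin_cases i <;> simp [expo]

lemma poly_ext {p q : Poly} (h : ∀ i j k : ℤ, intCoeff p i j k = intCoeff q i j k) : p = q := by
  ext m
  rw [← expo_apply m, ← intCoeff_natCast, ← intCoeff_natCast, h]

lemma intCoeff_add (p q : Poly) (i j k : ℤ) :
    intCoeff (p + q) i j k = intCoeff p i j k + intCoeff q i j k := by
  simp only [intCoeff, coeff_add]; split_ifs <;> simp

lemma intCoeff_sub (p q : Poly) (i j k : ℤ) :
    intCoeff (p - q) i j k = intCoeff p i j k - intCoeff q i j k := by
  simp only [intCoeff, coeff_sub]; split_ifs <;> simp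

lemma intCoeff_zero (i j k : ℤ) : intCoeff 0 i j k = 0 := by simp [intCoeff]

lemma intCoeff_C_mul (c : ℂ) (p : Poly) (i j k : ℤ) :
    intCoeff (C c * p) i j k = c * intCoeff p i j k := by
  simp only [intCoeff, coeff_C_mul]; split_ifs <;> simp

lemma intCoeff_C (c : ℂ) (i j k : ℤ) :
    intCoeff (C c) i j k = if i = 0 ∧ j = 0 ∧ k = 0 then c else 0 := by
  by_cases h : 0 ≤ i ∧ 0 ≤ j ∧ 0 ≤ k
  · obtain ⟨h1, h2, h3⟩ := h
    lift i to ℕ using h1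
    lift j to ℕ using h2
    lift k to ℕ using h3
    rw [intCoeff_natCast, coeff_C]
    refine if_congr ?_ rfl rfl
    rw [DFunLike.ext_iff, Fin.forall_fin_succ, Fin.forall_fin_succ, Fin.forall_fin_one]
    simp [expo, eq_comm]
  · rw [intCoeff_of_neg (by omega), if_neg (by omega)]

lemma coeff_expo_X_mul (s : Fin 3) (p : Poly) (m m' : Fin 3 →₀ ℕ)
    (h : m' = Finsupp.single s 1 + m) : coeff m' (X s * p) = coeff m p := by
  rw [h, coeff_X_mul]

lemma intCoeff_x_mul (p : Poly) (i j k : ℤ) :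
    intCoeff (x * p) i j k = intCoeff p (i - 1) j k := by
  by_cases h : 0 ≤ i ∧ 0 ≤ j ∧ 0 ≤ k
  · obtain ⟨h1, h2, h3⟩ := h
    lift i to ℕ using h1
    lift j to ℕ using h2
    lift k to ℕ using h3
    rw [intCoeff_natCast, x]
    cases i with
    | zero =>
      rw [coeff_X_mul', if_neg (by simp [expo]), intCoeff_of_neg (by simp)]
    | succ i =>
      rw [Nat.cast_succ, add_sub_cancel_right, intCoeff_natCast]
      exact coeff_expo_X_mul _ _ _ _ (by rw [expo, expo, Finsupp.single_add]; abel)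
  · rw [intCoeff_of_neg (by omega), intCoeff_of_neg (by omega)]

lemma intCoeff_y_mul (p : Poly) (i j k : ℤ) :
    intCoeff (y * p) i j k = intCoeff p i (j - 1) k := by
  by_cases h : 0 ≤ i ∧ 0 ≤ j ∧ 0 ≤ k
  · obtain ⟨h1, h2, h3⟩ := h
    lift i to ℕ using h1
    lift j to ℕ using h2
    lift k to ℕ using h3
    rw [intCoeff_natCast, y]
    cases j with
    | zero =>
      rw [coeff_X_mul', if_neg (by simp [expo]), intCoeff_of_neg (by simp)]
    | succ j =>
      rw [Nat.cast_succ, add_sub_cancel_right, intCoeff_natCast]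
      exact coeff_expo_X_mul _ _ _ _ (by rw [expo, expo, Finsupp.single_add]; abel)
  · rw [intCoeff_of_neg (by omega), intCoeff_of_neg (by omega)]

lemma intCoeff_z_mul (p : Poly) (i j k : ℤ) :
    intCoeff (z * p) i j k = intCoeff p i j (k - 1) := by
  by_cases h : 0 ≤ i ∧ 0 ≤ j ∧ 0 ≤ k
  · obtain ⟨h1, h2, h3⟩ := h
    lift i to ℕ using h1
    lift j to ℕ using h2
    lift k to ℕ using h3
    rw [intCoeff_natCast, z]
    cases k with
    | zero =>
      rw [coeff_X_mul', if_neg (by simp [expo]), intCoeff_of_neg (by simp)]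
    | succ k =>
      rw [Nat.cast_succ, add_sub_cancel_right, intCoeff_natCast]
      exact coeff_expo_X_mul _ _ _ _ (by rw [expo, expo, Finsupp.single_add]; abel)
  · rw [intCoeff_of_neg (by omega), intCoeff_of_neg (by omega)]

lemma intCoeff_pderiv_zero (p : Poly) (i j k : ℤ) :
    intCoeff (pderiv 0 p) i j k = (i + 1) * intCoeff p (i + 1) j k := by
  by_cases h : 0 ≤ i ∧ 0 ≤ j ∧ 0 ≤ k
  · obtain ⟨h1, h2, h3⟩ := h
    lift i to ℕ using h1
    lift j to ℕ using h2
    lift k to ℕ using h3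
    rw [intCoeff_natCast, coeff_pderiv, ← Int.natCast_succ i, intCoeff_natCast,
      show expo i j k + Finsupp.single 0 1 = expo (i + 1) j k by
        rw [expo, expo, Finsupp.single_add]; abel]
    simp [expo, mul_comm]
  · rw [intCoeff_of_neg (by omega)]
    by_cases hi : i = -1
    · simp [hi]
    · rw [intCoeff_of_neg (by omega), mul_zero]

lemma intCoeff_pderiv_one (p : Poly) (i j k : ℤ) :
    intCoeff (pderiv 1 p) i j k = (j + 1) * intCoeff p i (j + 1) k := by
  by_cases h : 0 ≤ i ∧ 0 ≤ j ∧ 0 ≤ k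
  · obtain ⟨h1, h2, h3⟩ := h
    lift i to ℕ using h1
    lift j to ℕ using h2
    lift k to ℕ using h3
    rw [intCoeff_natCast, coeff_pderiv, ← Int.natCast_succ j, intCoeff_natCast,
      show expo i j k + Finsupp.single 1 1 = expo i (j + 1) k by
        rw [expo, expo, Finsupp.single_add]; abel]
    simp [expo, mul_comm]
  · rw [intCoeff_of_neg (by omega)]
    by_cases hj : j = -1
    · simp [hj]
    · rw [intCoeff_of_neg (by omega), mul_zero]

lemma intCoeff_pderiv_two (p : Poly) (i j k : ℤ) :
    intCoeff (pderiv 2 p) i j k = (k + 1) * intCoeff p i j (k + 1) := by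
  by_cases h : 0 ≤ i ∧ 0 ≤ j ∧ 0 ≤ k
  · obtain ⟨h1, h2, h3⟩ := h
    lift i to ℕ using h1
    lift j to ℕ using h2
    lift k to ℕ using h3
    rw [intCoeff_natCast, coeff_pderiv, ← Int.natCast_succ k, intCoeff_natCast,
      show expo i j k + Finsupp.single 2 1 = expo i j (k + 1) by
        rw [expo, expo, Finsupp.single_add]; abel]
    simp [expo, mul_comm]
  · rw [intCoeff_of_neg (by omega)]
    by_cases hk : k = -1
    · simp [hk]
    · rw [intCoeff_of_neg (by omega), mul_zero]

lemma field_apply (α κ lam : ℝ) (p : Poly) :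
    field α 0 κ lam p = x * (y - 1) * pderiv 0 p +
      (const α * (1 - x ^ 2) - const κ * y) * pderiv 1 p +
      (x - const lam * z) * pderiv 2 p := by
  have : field α 0 κ lam = (x * (y - 1)) • pderiv 0 +
      (const α * (1 - x ^ 2) - const κ * y) • pderiv 1 + (x - const lam * z) • pderiv 2 := by
    refine derivation_ext fun i => ?_
    fin_cases i <;> simp [field, const, pderiv_X]
  simp [this]

/-- The slice of `𝔛 p` at `z^k` involves only slices `k` and `k + 1` of `p`. This triangular shape
permits descent from the top power of `z`. -/
lemma intCoeff_field (α κ lam : ℝ) (p : Poly) (i j k : ℤ) :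
    intCoeff (field α 0 κ lam p) i j k = planarField α κ (fun i j => intCoeff p i j k) i j +
      (k + 1) * intCoeff p (i - 1) j (k + 1) - lam * k * intCoeff p i j k := by
  rw [field_apply]
  have : x * (y - 1) * pderiv 0 p + (const α * (1 - x ^ 2) - const κ * y) * pderiv 1 p +
      (x - const lam * z) * pderiv 2 p = x * (y * pderiv 0 p) - x * pderiv 0 p +
      (C (α : ℂ) * (pderiv 1 p) - C (α : ℂ) * (x * (x * pderiv 1 p)) - C (κ : ℂ) * (y * pderiv 1 p)) +
      (x * pderiv 2 p - C (lam : ℂ) * (z * pderiv 2 p)) := by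
    ring
  rw [this]
  simp only [intCoeff_add, intCoeff_sub, intCoeff_C_mul, intCoeff_x_mul, intCoeff_y_mul,
    intCoeff_z_mul, intCoeff_pderiv_zero, intCoeff_pderiv_one, intCoeff_pderiv_two, planarField]
  rw [show i - 1 - 1 = i - 2 by ring]
  simp only [sub_add_cancel]
  push_cast
  ring

lemma intCoeff_eq_zero_of_totalDegree_lt {p : Poly} {i j k : ℤ} (h : p.totalDegree < i + j + k) :
    intCoeff p i j k = 0 := by
  rw [intCoeff]
  split_ifs with h0
  · apply coeff_eq_zero_of_totalDegree_lt
    rw [← Finsupp.degree_apply]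
    simp only [expo, map_add, Finsupp.degree_single]
    omega
  · rfl

lemma isPlanarArray_intCoeff (p : Poly) (k : ℤ) : IsPlanarArray fun i j => intCoeff p i j k where
  neg_left _ _ h := intCoeff_of_neg (.inl h)
  neg_right _ _ h := intCoeff_of_neg (.inr (.inl h))
  bounded := ⟨p.totalDegree - k, fun _ _ h => intCoeff_eq_zero_of_totalDegree_lt (by omega)⟩

lemma totalDegree_le_of_intCoeff {p : Poly} {n : ℕ}
    (h : ∀ i j k : ℤ, n < i + j + k → intCoeff p i j k = 0) : p.totalDegree ≤ n := by
  refine Finset.sup_le fun m hm => ?_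
  change m.degree ≤ n
  by_contra hlt
  rw [← expo_apply m, mem_support_iff, ← intCoeff_natCast] at hm
  refine hm (h _ _ _ ?_)
  have : m.degree = m 0 + m 1 + m 2 := by rw [Finsupp.degree_eq_sum, Fin.sum_univ_three]
  omega

lemma totalDegree_field_le (α κ lam : ℝ) (p : Poly) :
    (field α 0 κ lam p).totalDegree ≤ p.totalDegree + 1 := by
  refine totalDegree_le_of_intCoeff fun i j k h => ?_
  push_cast at h
  have hz : ∀ i' j' k' : ℤ, i + j + k - 1 ≤ i' + j' + k' → intCoeff p i' j' k' = 0 :=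
    fun _ _ _ h' => intCoeff_eq_zero_of_totalDegree_lt (by omega)
  rw [intCoeff_field, planarField, hz i j k (by omega), hz i (j - 1) k (by omega),
    hz i (j + 1) k (by omega), hz (i - 2) (j + 1) k (by omega), hz (i - 1) j (k + 1) (by omega)]
  simp

/-- A polynomial of degree at most one is affine. -/
lemma eq_affine_of_totalDegree_le_one {L : Poly} (hL : L.totalDegree ≤ 1) :
    L = const (intCoeff L 0 0 0) + const (intCoeff L 1 0 0) * x + const (intCoeff L 0 1 0) * y +
      const (intCoeff L 0 0 1) * z := by
  refine poly_ext fun i j k => ?_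
  rw [show const (intCoeff L 1 0 0) * x = x * C (intCoeff L 1 0 0) from mul_comm _ _,
    show const (intCoeff L 0 1 0) * y = y * C (intCoeff L 0 1 0) from mul_comm _ _,
    show const (intCoeff L 0 0 1) * z = z * C (intCoeff L 0 0 1) from mul_comm _ _]
  simp only [intCoeff_add, intCoeff_x_mul, intCoeff_y_mul, intCoeff_z_mul, intCoeff_C]
  by_cases h : (0 ≤ i ∧ 0 ≤ j ∧ 0 ≤ k) ∧ i + j + k ≤ 1
  · have : (i = 0 ∧ j = 0 ∧ k = 0) ∨ (i = 1 ∧ j = 0 ∧ k = 0) ∨ (i = 0 ∧ j = 1 ∧ k = 0) ∨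
      (i = 0 ∧ j = 0 ∧ k = 1) := by omega
    rcases this with ⟨rfl, rfl, rfl⟩ | ⟨rfl, rfl, rfl⟩ | ⟨rfl, rfl, rfl⟩ | ⟨rfl, rfl, rfl⟩ <;> simp
  · rw [if_neg (by omega), if_neg (by omega), if_neg (by omega), if_neg (by omega)]
    by_cases h0 : 0 ≤ i ∧ 0 ≤ j ∧ 0 ≤ k
    · rw [intCoeff_eq_zero_of_totalDegree_lt (by omega)]; simp
    · rw [intCoeff_of_neg (by omega)]; simp

lemma x_dvd_iff {p : Poly} : x ∣ p ↔ ∀ j k : ℤ, intCoeff p 0 j k = 0 := by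
  constructor
  · rintro ⟨q, rfl⟩ j k
    rw [intCoeff_x_mul, intCoeff_of_neg (by simp)]
  · intro h
    rw [x, X_dvd_iff_modMonomial_eq_zero]
    ext m
    by_cases hm : Finsupp.single 0 1 ≤ m
    · rw [coeff_modMonomial_of_le _ hm, coeff_zero]
    · rw [coeff_modMonomial_of_not_le _ hm, coeff_zero, ← expo_apply m, ← intCoeff_natCast]
      have : m 0 = 0 := by
        by_contra h0
        exact hm (Finsupp.single_le_iff.mpr (by omega))
      rw [this]
      exact h _ _

lemma intCoeff_x (i j k : ℤ) : intCoeff x i j k = if i = 1 ∧ j = 0 ∧ k = 0 then 1 else 0 := by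
  rw [← mul_one x, ← C_1, intCoeff_x_mul, intCoeff_C]
  simp [sub_eq_zero]

lemma intCoeff_z (i j k : ℤ) : intCoeff z i j k = if i = 0 ∧ j = 0 ∧ k = 1 then 1 else 0 := by
  rw [← mul_one z, ← C_1, intCoeff_z_mul, intCoeff_C]
  simp [sub_eq_zero]

lemma field_C (α β κ lam : ℝ) (c : ℂ) : field α β κ lam (C c) = 0 := derivation_C _ _

lemma field_x (α κ lam : ℝ) : field α 0 κ lam x = (y - 1) * x := by
  simp [field, x, const]; ring

lemma field_z (α κ lam : ℝ) : field α 0 κ lam z = x - const lam * z := by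
  simp [field, z]

lemma field_x_pow (α κ lam : ℝ) (n : ℕ) :
    field α 0 κ lam (x ^ n) = const n * (y - 1) * x ^ n := by
  rw [Derivation.leibniz_pow, field_x, const]
  rcases n with _ | n
  · simp
  · simp only [Nat.add_sub_cancel, smul_eq_mul, nsmul_eq_mul, map_natCast]
    ring

lemma field_C_mul (α β κ lam : ℝ) (c : ℂ) (p : Poly) :
    field α β κ lam (C c * p) = C c * field α β κ lam p := by
  rw [C_mul', Derivation.map_smul, C_mul']

/-! ### Polynomials dividing their derivative -/

section Classification

variable {α κ lam : ℝ}

/-- Descent on powers of `z`: a top slice of index `n ≥ 2` would be a nonzero constant `a`, leaving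
the source `-n a x` in the slice below, which is impossible. With only slices 1 and 0 left, the
sources are small enough for the planar lemma to make both constant. -/
lemma eq_linear_of_field_eq (hα : α ≠ 0) (hκ : κ ≠ 0) (hακ : α ≠ κ * (1 - κ)) {h L : Poly} {c : ℂ}
    (hL : L.totalDegree ≤ 1) (hcL : c = 0 ∨ L = 0) (hE : field α 0 κ lam h = const c * h + L) :
    h = const (intCoeff h 0 0 1) * z + const (intCoeff h 0 0 0) := by
  have hα' : (α : ℂ) ≠ 0 := by exact_mod_cast hα
  have hκ' : (κ : ℂ) ≠ 0 := by exact_mod_cast hκ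
  have hακ' : (α : ℂ) ≠ κ * (1 - κ) := by exact_mod_cast hακ
  have hslice : ∀ k i j : ℤ, planarField α κ (fun i j => intCoeff h i j k) i j =
      (c + lam * k) * intCoeff h i j k +
        (intCoeff L i j k - (k + 1) * intCoeff h (i - 1) j (k + 1)) := by
    intro k i j
    have := congrArg (fun p => intCoeff p i j k) hE
    simp only [intCoeff_field, intCoeff_add, intCoeff_C_mul] at this
    linear_combination this
  have hL0 : ∀ i j k : ℤ, 1 < i + j + k → intCoeff L i j k = 0 := fun i j k hlt =>
    intCoeff_eq_zero_of_totalDegree_lt (by omega)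
  have hLz : ∀ i j k : ℤ, 1 ≤ k → (i, j, k) ≠ (0, 0, 1) → intCoeff L i j k = 0 := by
    intro i j k hk hne
    rcases lt_or_ge i 0 with hi | hi
    · exact intCoeff_of_neg (by omega)
    rcases lt_or_ge j 0 with hj | hj
    · exact intCoeff_of_neg (by omega)
    · refine hL0 _ _ _ ?_
      simp only [ne_eq, Prod.mk.injEq] at hne
      omega
  have hhigh : ∀ i j k : ℤ, 2 ≤ k → intCoeff h i j k = 0 := by
    by_contra! hcon
    obtain ⟨i₁, j₁, k₁, hk₁, hne₁⟩ := hcon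
    obtain ⟨n, ⟨i₀, j₀, hne₀⟩, hmax⟩ := Int.exists_greatest_of_bdd
      (P := fun k => ∃ i j, intCoeff h i j k ≠ 0)
      ⟨h.totalDegree, by
        rintro k ⟨i, j, hne⟩
        by_contra hk
        refine hne ?_
        by_cases hij : i < 0 ∨ j < 0
        · exact intCoeff_of_neg (by omega)
        · exact intCoeff_eq_zero_of_totalDegree_lt (by omega)⟩
      ⟨k₁, i₁, j₁, hne₁⟩
    have hn2 : 2 ≤ n := hk₁.trans (hmax _ ⟨i₁, j₁, hne₁⟩)
    have hz : ∀ i j, intCoeff h i j (n + 1) = 0 := fun i j => by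
      by_contra hne; have := hmax _ ⟨i, j, hne⟩; omega
    have htop : ∀ i j : ℤ, (i, j) ≠ (0, 0) → intCoeff h i j n = 0 := fun i j hij =>
      (isPlanarArray_intCoeff h n).eq_zero_of_planarField (k := c + lam * n) (r := 0) hα' hκ' hακ'
        (fun i j => by
          rw [hslice, hz, hLz i j n (by omega) (by simp; omega)]; simp) (by simp) (by simp) hij
    have hn0 : intCoeff h 0 0 n ≠ 0 := by
      intro h0
      by_cases hij : (i₀, j₀) = (0, 0)
      · obtain ⟨rfl, rfl⟩ := Prod.mk.inj hij
        exact hne₀ h0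
      · exact hne₀ (htop _ _ hij)
    -- At position `(1, 0)` the source of slice `n - 1` is `-n` times the constant top slice.
    have := (isPlanarArray_intCoeff h (n - 1)).odd_source_eq_zero (hslice (n - 1))
      (fun i j hi hj => by
        rw [hLz i j _ (by omega) (by simp; omega), sub_add_cancel, htop _ _ (by simp; omega)]
        simp) odd_one 0
    rw [hLz _ _ _ (by omega) (by simp), sub_add_cancel, sub_self] at this
    push_cast at this
    rw [sub_add_cancel, zero_sub, neg_eq_zero] at this
    exact mul_ne_zero (by exact_mod_cast (by omega : n ≠ 0)) hn0 this
  have hone : ∀ i j : ℤ, (i, j) ≠ (0, 0) → intCoeff h i j 1 = 0 := fun i j hij =>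
    (isPlanarArray_intCoeff h 1).eq_zero_of_planarField (k := c + lam * (1 : ℤ))
      (r := fun i j => intCoeff L i j 1) hα' hκ' hακ'
      (fun i j => by rw [hslice, hhigh (i - 1) j (1 + 1) (by omega)]; simp)
      (fun i j h1 _ _ => hLz i j 1 le_rfl (by simpa using h1))
      (fun _ => hLz _ _ _ le_rfl (by simp)) hij
  have hzero : ∀ i j : ℤ, (i, j) ≠ (0, 0) → intCoeff h i j 0 = 0 := fun i j hij =>
    (isPlanarArray_intCoeff h 0).eq_zero_of_planarField (k := c)
      (r := fun i j => intCoeff L i j 0 - intCoeff h (i - 1) j 1) hα' hκ' hακ'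
      (fun i j => by rw [hslice]; simp)
      (fun i j h1 h2 h3 => by
        simp only [ne_eq, Prod.mk.injEq] at h1 h2
        rcases lt_or_ge i 0 with hi | hi
        · rw [intCoeff_of_neg (by omega), intCoeff_of_neg (by omega), sub_self]
        rcases lt_or_ge j 0 with hj | hj
        · rw [intCoeff_of_neg (by omega), intCoeff_of_neg (by omega), sub_self]
        have h4 : ¬(i = 1 ∧ j = 0) := by
          rintro ⟨rfl, rfl⟩
          exact absurd (h3 odd_one) (by omega)
        rw [hL0 _ _ _ (by omega), hone _ _ (by simp; omega), sub_self])
      (fun hc => by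
        rw [hcL.resolve_left hc, intCoeff_zero, intCoeff_of_neg (by omega), sub_self]) hij
  refine poly_ext fun i j k => ?_
  rw [mul_comm, intCoeff_add, intCoeff_z_mul, intCoeff_C, intCoeff_C]
  rcases lt_or_ge k 0 with hk | hk
  · rw [intCoeff_of_neg (by omega), if_neg (by omega), if_neg (by omega), add_zero]
  by_cases hk2 : 2 ≤ k
  · rw [hhigh _ _ _ hk2, if_neg (by omega), if_neg (by omega), add_zero]
  by_cases hij : (i, j) = (0, 0)
  · obtain ⟨rfl, rfl⟩ := Prod.mk.inj hij
    obtain rfl | rfl : k = 0 ∨ k = 1 := by omega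
    · simp
    · simp
  · have hij' : ¬ (i = 0 ∧ j = 0) := by simpa using hij
    rw [if_neg (by omega), if_neg (by omega), add_zero]
    obtain rfl | rfl : k = 0 ∨ k = 1 := by omega
    · exact hzero _ _ hij
    · exact hone _ _ hij

lemma field_linear (c d : ℂ) :
    field α 0 κ lam (const c * z + const d) = const c * (x - const lam * z) := by
  rw [map_add, field_C_mul, field_C, field_z, add_zero]

lemma intCoeff_x_sub_z (c : ℂ) :
    intCoeff (const c * (x - const lam * z)) 1 0 0 = c := by
  simp [intCoeff_C_mul, intCoeff_sub, intCoeff_x, intCoeff_z]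

/-- For `h = a z + b`, the derivative contains `a x`, while `c h` has no `x` term; so `a = 0`. -/
lemma eq_const_of_field_eq_const_mul (hα : α ≠ 0) (hκ : κ ≠ 0) (hακ : α ≠ κ * (1 - κ)) {h : Poly}
    {c : ℂ} (hE : field α 0 κ lam h = const c * h) : ∃ d, h = const d := by
  have hlin := eq_linear_of_field_eq (L := 0) hα hκ hακ (by simp) (.inr rfl) (by rw [hE, add_zero])
  refine ⟨intCoeff h 0 0 0, ?_⟩
  set a := intCoeff h 0 0 1
  set b := intCoeff h 0 0 0
  rw [hlin, field_linear] at hE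
  have := congrArg (fun p => intCoeff p 1 0 0) hE
  simp only [intCoeff_x_sub_z] at this
  have ha : a = 0 := by
    rw [this]
    simp [intCoeff_C_mul, intCoeff_add, intCoeff_z, intCoeff_C]
  rw [hlin, ha, const, map_zero, zero_mul, zero_add]

/-- Along the invariant plane `x = 0`, a cofactor cannot depend on `y`. -/
lemma cofactor_y_eq_zero {h q : Poly} {c d : ℂ} (hx : ¬ x ∣ h)
    (hE : field α 0 κ lam h = (const c + const d * y) * h + x * q) : d = 0 := by
  rw [x_dvd_iff] at hx
  push Not at hx
  obtain ⟨j₁, k₁, hne₁⟩ := hx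
  obtain ⟨J, ⟨K, hne⟩, hmax⟩ := Int.exists_greatest_of_bdd
    (P := fun j => ∃ k, intCoeff h 0 j k ≠ 0)
    ⟨h.totalDegree, by
      rintro j ⟨k, hne⟩
      by_contra hj
      refine hne ?_
      by_cases hk : k < 0
      · exact intCoeff_of_neg (by omega)
      · exact intCoeff_eq_zero_of_totalDegree_lt (by omega)⟩
    ⟨j₁, k₁, hne₁⟩
  have hz : ∀ j k, J < j → intCoeff h 0 j k = 0 := fun j k hj => by
    by_contra hne; have := hmax _ ⟨k, hne⟩; omega
  -- On `x = 0` the field does not raise the `y`-degree, whereas `d y` does.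
  have := congrArg (fun p => intCoeff p 0 (J + 1) K) hE
  simp only [intCoeff_field, planarField] at this
  rw [hz (J + 1) K (by omega), hz (J + 1 + 1) K (by omega), intCoeff_of_neg (i := 0 - 2) (by omega),
    intCoeff_of_neg (i := 0 - 1) (by omega),
    show (const c + const d * y) * h + x * q = C c * h + C d * (y * h) + x * q by ring,
    intCoeff_add, intCoeff_add, intCoeff_C_mul, intCoeff_C_mul, intCoeff_x_mul, intCoeff_y_mul,
    hz (J + 1) K (by omega), intCoeff_of_neg (i := 0 - 1) (by omega), add_sub_cancel_right] at this
  simpa [hne] using this.symm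

/-- Removing the full power `x ^ n` subtracts `n (y - 1)` from the cofactor. The quotient is prime
to `x`, so its cofactor is constant, and then so is the quotient. -/
lemma eq_const_mul_x_pow_of_even_cofactor (hα : α ≠ 0) (hκ : κ ≠ 0) (hακ : α ≠ κ * (1 - κ))
    {h : Poly} {c d : ℂ} (h0 : h ≠ 0)
    (hE : field α 0 κ lam h = (const c + const d * y) * h) :
    ∃ (e : ℂ) (n : ℕ), h = const e * x ^ n := by
  have hxp : Prime x := X_prime
  obtain ⟨n, q, hq, rfl⟩ := WfDvdMonoid.max_power_factor h0 hxp.irreducible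
  have hx0 : (x ^ n : Poly) ≠ 0 := pow_ne_zero _ hxp.ne_zero
  have hq' : field α 0 κ lam q = (const (c + n) + const (d - n) * y) * q := by
    rw [Derivation.leibniz, field_x_pow, smul_eq_mul, smul_eq_mul] at hE
    apply mul_left_cancel₀ hx0
    simp only [const, map_add, map_sub] at hE ⊢
    linear_combination hE
  have hd : d - n = 0 := cofactor_y_eq_zero (c := c + n) (q := 0) hq (by rw [hq']; ring)
  rw [hd] at hq'
  obtain ⟨e, rfl⟩ := eq_const_of_field_eq_const_mul hα hκ hακ (c := c + n) (by rw [hq']; simp)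
  exact ⟨e, n, mul_comm _ _⟩

/-- The symmetry `(x, y, z) ↦ (-x, y, -z)` of the field. -/
noncomputable def reflect : Poly →ₐ[ℂ] Poly := aeval ![-x, y, -z]

lemma reflect_x : reflect x = -x := by simp [reflect, x]

lemma reflect_y : reflect y = y := by simp [reflect, y]

lemma reflect_z : reflect z = -z := by simp [reflect, z]

lemma reflect_C (c : ℂ) : reflect (C c) = C c := by simp [reflect]

lemma reflect_reflect (p : Poly) : reflect (reflect p) = p := by
  have : reflect.comp reflect = AlgHom.id ℂ Poly := by
    refine algHom_ext fun i => ?_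
    fin_cases i
    · change reflect (reflect x) = x; simp [reflect_x]
    · change reflect (reflect y) = y; simp [reflect_y]
    · change reflect (reflect z) = z; simp [reflect_z]
  exact DFunLike.congr_fun this p

lemma field_y (α κ lam : ℝ) :
    field α 0 κ lam y = const α * (1 - x ^ 2) - const κ * y := by
  simp [field, y]

lemma reflect_field (p : Poly) : reflect (field α 0 κ lam p) = field α 0 κ lam (reflect p) := by
  induction p using MvPolynomial.induction_on with
  | C c => simp only [field_C, reflect_C, map_zero]
  | add p q hp hq => simp only [map_add, hp, hq]
  | mul_X p i hp =>
    have hi : reflect (field α 0 κ lam (X i)) = field α 0 κ lam (reflect (X i)) := by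
      fin_cases i
      · change reflect (field α 0 κ lam x) = field α 0 κ lam (reflect x)
        simp only [field_x, reflect_x, reflect_y, map_mul, map_sub, map_one, map_neg]; ring
      · change reflect (field α 0 κ lam y) = field α 0 κ lam (reflect y)
        simp only [field_y, reflect_x, reflect_y, map_mul, map_sub, map_one, map_pow, const,
          reflect_C]; ring
      · change reflect (field α 0 κ lam z) = field α 0 κ lam (reflect z)
        simp only [field_z, reflect_x, reflect_z, map_mul, map_sub, map_neg, const, reflect_C]; ring
    simp only [Derivation.leibniz, smul_eq_mul, map_mul, map_add, hp, hi]

lemma totalDegree_cofactor_le {h K : Poly} (h0 : h ≠ 0) (hE : field α 0 κ lam h = K * h) :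
    K.totalDegree ≤ 1 := by
  by_cases hK : K = 0
  · simp [hK]
  · have := totalDegree_field_le α κ lam h
    rw [hE, totalDegree_mul_of_isDomain hK h0] at this
    omega

/-- Polynomials dividing their derivative along the field are monomials in `x`. -/
lemma eq_const_mul_x_pow (hα : α ≠ 0) (hκ : κ ≠ 0) (hακ : α ≠ κ * (1 - κ)) {h K : Poly}
    (h0 : h ≠ 0) (hE : field α 0 κ lam h = K * h) :
    ∃ (c : ℂ) (n : ℕ), c ≠ 0 ∧ h = const c * x ^ n ∧ K = const n * (y - 1) := by
  have hK := eq_affine_of_totalDegree_le_one (totalDegree_cofactor_le h0 hE)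
  have hr0 : reflect h ≠ 0 := fun hr => h0 (by rw [← reflect_reflect h, hr, map_zero])
  set a := intCoeff K 0 0 0
  set b := intCoeff K 0 1 0
  -- The cofactor of the product is `K + reflect K`, in which the `x` and `z` terms cancel.
  have hprod : field α 0 κ lam (h * reflect h) = (const (2 * a) + const (2 * b) * y) *
      (h * reflect h) := by
    have hKr : K + reflect K = const (2 * a) + const (2 * b) * y := by
      rw [hK]
      simp only [map_add, map_mul, reflect_x, reflect_y, reflect_z, const, reflect_C]
      rw [show (C 2 : Poly) = 2 from map_ofNat C 2]
      ring
    rw [Derivation.leibniz, ← reflect_field, hE, map_mul, smul_eq_mul, smul_eq_mul, ← hKr]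
    ring
  obtain ⟨e, n, he⟩ := eq_const_mul_x_pow_of_even_cofactor hα hκ hακ (mul_ne_zero h0 hr0) hprod
  have he0 : e ≠ 0 := by
    rintro rfl
    exact mul_ne_zero h0 hr0 (by rw [he, const, map_zero, zero_mul])
  have hunit : IsUnit (const e) := (isUnit_iff_ne_zero.mpr he0).map C
  have hdvd : h ∣ x ^ n := hunit.dvd_mul_left.mp (he ▸ dvd_mul_right _ _)
  obtain ⟨m, -, hm⟩ := (dvd_prime_pow X_prime n).mp hdvd
  obtain ⟨u, hu⟩ := hm.symm
  obtain ⟨c, hc, hcu⟩ := (isUnit_iff_eq_C_of_isReduced (P := (u : Poly))).mp u.isUnit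
  have hh : h = const c * x ^ m := by rw [← hu, hcu, mul_comm]; rfl
  refine ⟨c, m, hc.ne_zero, hh, ?_⟩
  apply mul_right_cancel₀ h0
  rw [← hE, hh, field_C_mul, field_x_pow]
  ring

end Classification

/-! ### Darboux polynomials and exponential factors -/

section Algebraic

variable {α κ lam : ℝ}

lemma isDarbouxPolynomial_iff (hα : α ≠ 0) (hκ : κ ≠ 0) (hακ : α ≠ κ * (1 - κ)) (h K : Poly) :
    IsDarbouxPolynomial α 0 κ lam h K ↔
      ∃ (c : ℂ) (n : ℕ), c ≠ 0 ∧ 1 ≤ n ∧ h = const c * x ^ n ∧ K = const n * (y - 1) := by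
  constructor
  · rintro ⟨hne, hE⟩
    obtain ⟨c, n, hc, rfl, rfl⟩ := eq_const_mul_x_pow hα hκ hακ
      (fun h0 => hne 0 (by rw [h0, const, map_zero])) hE
    refine ⟨c, n, hc, Nat.one_le_iff_ne_zero.mpr ?_, rfl, rfl⟩
    rintro rfl
    exact hne c (by simp)
  · rintro ⟨c, n, hc, hn, rfl, rfl⟩
    refine ⟨fun d hd => hc ?_, ?_⟩
    · have := congrArg (fun p => coeff (Finsupp.single 0 n) p) hd
      have hn0 : n ≠ 0 := by omega
      simpa [x, coeff_C, coeff_X_pow, hn0, eq_comm] using this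
    · rw [field_C_mul, field_x_pow]
      ring

lemma const_mul_y_sub_one_ne_zero {n : ℕ} (hn : n ≠ 0) : const n * (y - 1) ≠ 0 := by
  refine mul_ne_zero (by simpa using hn) fun h => ?_
  have := congrArg (eval fun _ => (0 : ℂ)) h
  simp [y] at this

lemma isExponentialFactor_iff (hα : α ≠ 0) (hκ : κ ≠ 0) (hακ : α ≠ κ * (1 - κ)) (g h L : Poly) :
    IsExponentialFactor α 0 κ lam g h L ↔
      ∃ a c d : ℂ, a ≠ 0 ∧ c ≠ 0 ∧ h = const a ∧ g = (const c * z + const d) * h ∧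
        L = const c * (x - const lam * z) := by
  constructor
  · rintro ⟨h0, hcop, hne, hdeg, hE⟩
    -- The equation shows that `h` divides `g * 𝔛 h`, and `h` is coprime to `g`.
    have hdvd : h ∣ field α 0 κ lam h := by
      refine hcop.symm.dvd_of_dvd_mul_left ⟨field α 0 κ lam g - L * h, ?_⟩
      linear_combination -hE
    obtain ⟨K, hK⟩ := hdvd
    obtain ⟨e, n, he, hh, rfl⟩ := eq_const_mul_x_pow hα hκ hακ h0 (hK.trans (mul_comm _ _))
    have hg : field α 0 κ lam g = const n * (y - 1) * g + L * h := by
      apply mul_left_cancel₀ h0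
      linear_combination hE + g * hK
    rcases n with _ | n
    · rw [pow_zero, mul_one] at hh
      subst hh
      have hlin := eq_linear_of_field_eq (c := 0) (L := L * const e) hα hκ hακ
        ((totalDegree_mul _ _).trans (by simpa using hdeg)) (.inl rfl) (by rw [hg]; simp)
      set a := intCoeff g 0 0 1
      set b := intCoeff g 0 0 0
      have hee : (const e⁻¹ * const e : Poly) = 1 := by
        rw [const, ← C_mul, inv_mul_cancel₀ he, C_1]
      have ha : a ≠ 0 := by
        intro ha
        refine hne (b * e⁻¹) ?_
        rw [hlin, ha, const, const, const, C_mul, mul_assoc, hee]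
        simp
      refine ⟨e, a * e⁻¹, b * e⁻¹, he, mul_ne_zero ha (inv_ne_zero he), rfl, ?_, ?_⟩
      · rw [hlin]
        simp only [const, C_mul] at hee ⊢
        linear_combination -(C a * z + C b) * hee
      · have hLe : const a * (x - const lam * z) = L * const e := by
          rw [← field_linear (α := α) (κ := κ) (lam := lam) a b, ← hlin, hg]
          simp
        rw [const, C_mul]
        linear_combination -L * hee - const e⁻¹ * hLe
    · exfalso
      have hxp : Prime (x : Poly) := X_prime
      -- Here `x` divides `h`. Either coprimality fails, or `g` restricted to `x = 0` is nonzero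
      -- with a cofactor that depends on `y`.
      by_cases hx : x ∣ g
      · exact hxp.not_isUnit (hcop hx (hh ▸ Dvd.intro_left (const e * x ^ n) (by ring)))
      · have := cofactor_y_eq_zero (c := -(n + 1 : ℕ)) (d := (n + 1 : ℕ))
          (q := L * (const e * x ^ n)) hx (by rw [hg, hh]; simp only [const, map_neg]; ring)
        exact absurd this (Nat.cast_ne_zero.mpr n.succ_ne_zero)
  · rintro ⟨a, c, d, ha, hc, rfl, rfl, rfl⟩
    have ha' : (const a : Poly) ≠ 0 := by simpa using ha
    refine ⟨ha', ?_, fun e he => hc ?_, ?_, ?_⟩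
    · exact ((isUnit_iff_ne_zero.mpr ha).map C).isRelPrime_right
    · have := congrArg (fun p => intCoeff p 0 0 1) (mul_right_cancel₀ ha' he)
      simpa [intCoeff_add, intCoeff_C_mul, intCoeff_z, intCoeff_C] using this
    · refine totalDegree_le_of_intCoeff fun i j k hijk => ?_
      rw [intCoeff_C_mul, intCoeff_sub, intCoeff_C_mul, intCoeff_x, intCoeff_z,
        if_neg (by omega), if_neg (by omega)]
      simp
    · rw [Derivation.leibniz, field_linear, field_C]
      simp only [smul_eq_mul]
      ring

end Algebraic

/-! ### First integrals on open sets -/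

section Analytic

variable {α κ lam : ℝ}

lemma evalAt_C (c : ℂ) (P : Fin 3 → ℝ) : evalAt (C c) P = c := by simp [evalAt]

lemma evalAt_add (p q : Poly) (P : Fin 3 → ℝ) : evalAt (p + q) P = evalAt p P + evalAt q P :=
  map_add _ _ _

lemma evalAt_sub (p q : Poly) (P : Fin 3 → ℝ) : evalAt (p - q) P = evalAt p P - evalAt q P :=
  map_sub _ _ _

lemma evalAt_mul (p q : Poly) (P : Fin 3 → ℝ) : evalAt (p * q) P = evalAt p P * evalAt q P :=
  map_mul _ _ _

lemma evalAt_pow (p : Poly) (n : ℕ) (P : Fin 3 → ℝ) : evalAt (p ^ n) P = evalAt p P ^ n :=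
  map_pow _ _ _

lemma evalAt_one (P : Fin 3 → ℝ) : evalAt 1 P = 1 := map_one _

lemma evalAt_x (P : Fin 3 → ℝ) : evalAt x P = P 0 := by simp [evalAt, x]

lemma evalAt_y (P : Fin 3 → ℝ) : evalAt y P = P 1 := by simp [evalAt, y]

lemma evalAt_z (P : Fin 3 → ℝ) : evalAt z P = P 2 := by simp [evalAt, z]

/-- A polynomial that vanishes on a nonempty open subset of `ℝ³` is zero. -/
lemma eq_zero_of_evalAt_eq_zero {U : Set (Fin 3 → ℝ)} (hU : IsOpen U) (hne : U.Nonempty) {p : Poly}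
    (hp : ∀ P ∈ U, evalAt p P = 0) : p = 0 := by
  obtain ⟨P, hP⟩ := hne
  obtain ⟨ε, hε, hball⟩ := Metric.isOpen_iff.mp hU P hP
  refine funext_set (fun i => (fun t : ℝ => (t : ℂ)) '' Set.Ioo (P i - ε) (P i + ε)) (fun i => ?_)
    fun Q hQ => ?_
  · exact (Set.Ioo_infinite (by linarith)).image Complex.ofReal_injective.injOn
  · choose R hR hRQ using fun i => hQ i (Set.mem_univ i)
    have hRU : R ∈ U := by
      refine hball ?_
      rw [Metric.mem_ball, dist_pi_lt_iff hε]
      intro i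
      rw [Real.dist_eq, abs_lt]
      constructor <;> linarith [(hR i).1, (hR i).2]
    rw [map_zero, ← hp R hRU, evalAt]
    congr 2
    exact funext fun i => (hRQ i).symm

lemma exists_solution (α κ lam : ℝ) {U : Set (Fin 3 → ℝ)} (hU : IsOpen U) {P : Fin 3 → ℝ}
    (hP : P ∈ U) : ∃ (γ : ℝ → Fin 3 → ℝ) (ε : ℝ), 0 < ε ∧ γ 0 = P ∧
      IsSolutionOn α 0 κ lam γ (-ε) ε ∧ ∀ t ∈ Set.Ioo (-ε) ε, γ t ∈ U := by
  let v : (Fin 3 → ℝ) → (Fin 3 → ℝ) := fun Q =>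
    ![Q 0 * (Q 1 - 1) - 0 * Q 2, α * (1 - (Q 0) ^ 2) - κ * Q 1, Q 0 - lam * Q 2]
  have hv : ContDiff ℝ 1 v := by
    rw [contDiff_pi]
    intro i
    fin_cases i <;> simp [v] <;> fun_prop
  obtain ⟨γ, hγ0, ε, hε, hγ⟩ :=
    hv.contDiffAt.exists_forall_mem_closedBall_exists_eq_forall_mem_Ioo_hasDerivAt₀ (x₀ := P) 0
  rw [zero_sub, zero_add] at hγ
  have hcont : ContinuousAt γ 0 := (hγ 0 ⟨by linarith, hε⟩).continuousAt
  obtain ⟨δ, hδ, hball⟩ := Metric.mem_nhds_iff.mp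
    (hcont.preimage_mem_nhds (hU.mem_nhds (hγ0.symm ▸ hP)))
  refine ⟨γ, min ε δ, lt_min hε hδ, hγ0, fun t ht => ?_, fun t ht => hball ?_⟩
  · have := hasDerivAt_pi.mp (hγ t
      ⟨(neg_le_neg (min_le_left ε δ)).trans_lt ht.1, ht.2.trans_le (min_le_left ε δ)⟩)
    exact ⟨this 0, this 1, this 2⟩
  · rw [Metric.mem_ball, Real.dist_eq, sub_zero, abs_lt]
    exact ⟨(neg_le_neg (min_le_right ε δ)).trans_lt ht.1, ht.2.trans_le (min_le_right ε δ)⟩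

lemma IsSolutionOn.hasDerivAt_evalAt {γ : ℝ → Fin 3 → ℝ} {a b t : ℝ}
    (hγ : IsSolutionOn α 0 κ lam γ a b) (ht : t ∈ Set.Ioo a b) (p : Poly) :
    HasDerivAt (fun s => evalAt p (γ s)) (evalAt (field α 0 κ lam p) (γ t)) t := by
  induction p using MvPolynomial.induction_on with
  | C c =>
    rw [field_C, show evalAt 0 (γ t) = 0 from map_zero _]
    simpa only [evalAt_C] using hasDerivAt_const t c
  | add p q hp hq =>
    simp only [map_add, evalAt_add]
    exact hp.add hq
  | mul_X p i hp =>
    have hi : HasDerivAt (fun s => evalAt (X i) (γ s)) (evalAt (field α 0 κ lam (X i)) (γ t)) t := by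
      obtain ⟨h0, h1, h2⟩ := hγ t ht
      fin_cases i
      · change HasDerivAt (fun s => evalAt x (γ s)) (evalAt (field α 0 κ lam x) (γ t)) t
        rw [field_x]
        simp only [evalAt_x, evalAt_y, evalAt_mul, evalAt_sub, evalAt_one]
        convert h0.ofReal_comp using 1
        push_cast; ring
      · change HasDerivAt (fun s => evalAt y (γ s)) (evalAt (field α 0 κ lam y) (γ t)) t
        rw [field_y]
        simp only [evalAt_x, evalAt_y, evalAt_mul, evalAt_sub, evalAt_one, evalAt_pow, const,
          evalAt_C]
        convert h1.ofReal_comp using 1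
        push_cast; ring
      · change HasDerivAt (fun s => evalAt z (γ s)) (evalAt (field α 0 κ lam z) (γ t)) t
        rw [field_z]
        simp only [evalAt_x, evalAt_z, evalAt_mul, evalAt_sub, const, evalAt_C]
        convert h2.ofReal_comp using 1
        push_cast; ring
    simp only [Derivation.leibniz, smul_eq_mul, evalAt_add, evalAt_mul]
    exact (hp.mul hi).congr_deriv (by ring)

/-- A first integral has zero derivative along the solutions. -/
lemma IsFirstIntegralOn.deriv_eq_zero {U : Set (Fin 3 → ℝ)} {H : (Fin 3 → ℝ) → ℂ}
    (hH : IsFirstIntegralOn α 0 κ lam U H) {γ : ℝ → Fin 3 → ℝ} {ε : ℝ} (hε : 0 < ε)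
    (hγ : IsSolutionOn α 0 κ lam γ (-ε) ε) (hγU : ∀ t ∈ Set.Ioo (-ε) ε, γ t ∈ U) {H' : ℂ}
    (hd : HasDerivAt (fun s => H (γ s)) H' 0) : H' = 0 := by
  have h0 : (0 : ℝ) ∈ Set.Ioo (-ε) ε := ⟨by linarith, hε⟩
  refine hd.unique ((hasDerivAt_const 0 (H (γ 0))).congr_of_eventuallyEq ?_)
  filter_upwards [Ioo_mem_nhds h0.1 h0.2] with s hs
  exact hH.constant_along γ _ _ hγ hγU s hs 0 h0

lemma not_hasPolynomialFirstIntegral (hα : α ≠ 0) (hκ : κ ≠ 0) (hακ : α ≠ κ * (1 - κ)) :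
    ¬ HasPolynomialFirstIntegral α 0 κ lam := by
  rintro ⟨h, U, hH⟩
  obtain ⟨P, hP, Q, hQ, hPQ⟩ := hH.nonconstant
  have hfield : field α 0 κ lam h = 0 := by
    refine eq_zero_of_evalAt_eq_zero hH.isOpen ⟨P, hP⟩ fun R hR => ?_
    obtain ⟨γ, ε, hε, rfl, hγ, hγU⟩ := exists_solution α κ lam hH.isOpen hR
    exact hH.deriv_eq_zero hε hγ hγU (hγ.hasDerivAt_evalAt ⟨by linarith, hε⟩ h)
  obtain ⟨d, rfl⟩ := eq_const_of_field_eq_const_mul (c := 0) hα hκ hακ (by rw [hfield]; simp)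
  exact hPQ (by rw [evalAt_C, evalAt_C])

/-- A continuous branch of `log (c * x ^ n)` on a connected set is `n * log |x|` up to a
constant. -/
lemma exists_branch_eq {U : Set (Fin 3 → ℝ)} (hU : IsPreconnected U) {ℓ : (Fin 3 → ℝ) → ℂ}
    (hℓ : ContinuousOn ℓ U) {c : ℂ} {n : ℕ}
    (hexp : ∀ P ∈ U, Complex.exp (ℓ P) = c * (P 0 : ℂ) ^ n) (hx : ∀ P ∈ U, P 0 ≠ 0) :
    ∃ e : ℂ, ∀ P ∈ U, ℓ P = n * (Real.log (P 0) : ℂ) + e := by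
  rcases U.eq_empty_or_nonempty with rfl | ⟨P₀, hP₀⟩
  · exact ⟨0, by simp⟩
  -- `Real.log` is `log |x|`, so the difference is a logarithm of `c` only up to sign; doubling
  -- gives a continuous logarithm of the constant `c ^ 2`.
  let F : (Fin 3 → ℝ) → ℂ := fun P => 2 * (ℓ P - n * (Real.log (P 0) : ℂ))
  have hF : ContinuousOn F U := by
    have hlog : ContinuousOn (fun P : Fin 3 → ℝ => (Real.log (P 0) : ℂ)) U :=
      Complex.continuous_ofReal.comp_continuousOn
        (ContinuousOn.log (continuous_apply 0).continuousOn hx)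
    exact continuousOn_const.mul (hℓ.sub (continuousOn_const.mul hlog))
  have hexpF : ∀ P ∈ U, Complex.exp (F P) = c ^ 2 := by
    intro P hP
    have hxP : (P 0 : ℂ) ≠ 0 := by exact_mod_cast hx P hP
    have hlogx : Complex.exp (Real.log (P 0)) ^ 2 = (P 0 : ℂ) ^ 2 := by
      rw [← Complex.ofReal_exp, Real.exp_log_eq_abs (hx P hP)]
      exact_mod_cast sq_abs (P 0)
    have h2 : Complex.exp (F P) = Complex.exp (ℓ P - n * (Real.log (P 0) : ℂ)) ^ 2 := by
      rw [← Complex.exp_nat_mul]; simp [F]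
    rw [h2, Complex.exp_sub, hexp P hP, Complex.exp_nat_mul, div_pow, mul_pow, ← pow_mul, ← pow_mul,
      mul_comm n 2, pow_mul, pow_mul, hlogx]
    field_simp
  have hconst : ∀ P ∈ U, F P = F P₀ := fun P hP =>
    Complex.isCoveringMap_exp.constOn_of_comp hU hF
      (fun a ha a' ha' => Subtype.ext ((hexpF a ha).trans (hexpF a' ha').symm)) hP hP₀
  refine ⟨F P₀ / 2, fun P hP => ?_⟩
  rw [← hconst P hP]
  simp only [F]
  ring

lemma not_isDarbouxIntegrable (hα : α ≠ 0) (hκ : κ ≠ 0) (hακ : α ≠ κ * (1 - κ)) :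
    ¬ IsDarbouxIntegrable α 0 κ lam := by
  rintro ⟨U, G, hU, ⟨p, q, f, a, ℓ, g, h, μ, hf, hg, hℓ, -, hG⟩, hH⟩
  obtain ⟨P, hP, Q, hQ, hPQ⟩ := hH.nonconstant
  choose K hK using hf
  choose c n hc hn hfx hK' using fun j => (isDarbouxPolynomial_iff hα hκ hακ _ _).mp (hK j)
  choose L hL using hg
  choose b m d hb hm hh hgz hL' using fun k => (isExponentialFactor_iff hα hκ hακ _ _ _).mp (hL k)
  have hevalf : ∀ j P, evalAt (f j) P = c j * (P 0 : ℂ) ^ n j := fun j P => by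
    rw [hfx, evalAt_mul, evalAt_C, evalAt_pow, evalAt_x]
  -- A logarithm of a multiple of `x ^ n` with `n ≥ 1` keeps `U` off the plane `x = 0`. Without such
  -- factors `U` may meet the plane, but then `A` is an empty sum.
  have hx : 0 < p → ∀ P ∈ U, P 0 ≠ 0 := by
    intro hp P hP h0
    have := (hℓ ⟨0, hp⟩).2 P hP
    rw [hevalf, h0, Complex.ofReal_zero, zero_pow (Nat.one_le_iff_ne_zero.mp (hn _)), mul_zero] at this
    exact Complex.exp_ne_zero _ this
  choose e he using fun j => exists_branch_eq hU (hℓ j).1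
    (fun P hP => ((hℓ j).2 P hP).trans (hevalf j P)) (hx j.pos)
  set A : ℂ := ∑ j, a j * n j with hA
  set B : ℂ := ∑ k, μ k * m k with hB
  set D : ℂ := ∑ j, a j * e j + ∑ k, μ k * d k with hD
  have hG' : ∀ P ∈ U, G P = Complex.exp (A * (Real.log (P 0) : ℂ) + B * P 2 + D) := by
    intro P hP
    rw [hG P hP, ← Complex.exp_sum, ← Complex.exp_sum, ← Complex.exp_add]
    have h1 : ∑ j, a j * ℓ j P = A * (Real.log (P 0) : ℂ) + ∑ j, a j * e j := by
      rw [hA, Finset.sum_mul, ← Finset.sum_add_distrib]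
      exact Finset.sum_congr rfl fun j _ => by rw [he j P hP]; ring
    have h2 : ∑ k, μ k * (evalAt (g k) P / evalAt (h k) P) = B * P 2 + ∑ k, μ k * d k := by
      rw [hB, Finset.sum_mul, ← Finset.sum_add_distrib]
      refine Finset.sum_congr rfl fun k _ => ?_
      rw [hgz, evalAt_mul, hh, evalAt_C, mul_div_cancel_right₀ _ (hb k), evalAt_add, evalAt_mul,
        evalAt_C, evalAt_C, evalAt_z]
      ring
    rw [h1, h2, hD]
    ring_nf
  -- This is the logarithmic derivative of `G` along a solution through an arbitrary point of `U`.
  have hpoly : C A * (y - 1) + C B * (x - C (lam : ℂ) * z) = 0 := by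
    refine eq_zero_of_evalAt_eq_zero hH.isOpen ⟨P, hP⟩ fun R hR => ?_
    obtain ⟨γ, ε, hε, rfl, hγ, hγU⟩ := exists_solution α κ lam hH.isOpen hR
    have ht : (0 : ℝ) ∈ Set.Ioo (-ε) ε := ⟨by linarith, hε⟩
    obtain ⟨hγx, -, hγz⟩ := hγ 0 ht
    have hlog : HasDerivAt (fun s => A * (Real.log (γ s 0) : ℂ)) (A * (γ 0 1 - 1 : ℝ)) 0 := by
      rcases Nat.eq_zero_or_pos p with rfl | hp
      · have : A = 0 := by simp [hA]
        simpa [this] using hasDerivAt_const (0 : ℝ) (0 : ℂ)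
      · have h0 := hx hp _ hR
        refine HasDerivAt.const_mul A ?_
        refine (hγx.log h0).ofReal_comp.congr_deriv (Complex.ofReal_inj.mpr ?_)
        rw [zero_mul, sub_zero, mul_div_cancel_left₀ _ h0]
    have hexp := ((hlog.add ((hγz.ofReal_comp).const_mul B)).add_const D).cexp
    have hGγ : HasDerivAt (fun s => G (γ s)) _ 0 := hexp.congr_of_eventuallyEq (by
      filter_upwards [Ioo_mem_nhds ht.1 ht.2] with s hs
      rw [hG' _ (hγU s hs)]; rfl)
    have := (mul_eq_zero.mp (hH.deriv_eq_zero hε hγ hγU hGγ)).resolve_left (Complex.exp_ne_zero _)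
    simp only [evalAt_add, evalAt_sub, evalAt_mul, evalAt_C, evalAt_x, evalAt_y, evalAt_z, evalAt_one]
    rw [← this]
    push_cast
    ring
  have heval : ∀ X Y : ℂ, A * (Y - 1) + B * X = 0 := by
    intro X Y
    have := congrArg (eval ![X, Y, 0]) hpoly
    simpa [x, y, z] using this
  have hA0 : A = 0 := by linear_combination heval 0 2
  have hB0 : B = 0 := by linear_combination heval 1 1
  exact hPQ (by rw [hG' P hP, hG' Q hQ, hA0, hB0]; simp)

end Analytic

end HSA

theorem theorem2 (α κ lam : ℝ) (hα : α ≠ 0) (hκ : κ ≠ 0) (hακ : α ≠ -κ * (κ - 1)) :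
    -- (a) there is no polynomial first integral
    ¬ HSA.HasPolynomialFirstIntegral α 0 κ lam ∧
    -- (b) the Darboux polynomials with nonzero cofactor are exactly `x`, up to powers and
    -- constant multiples
    (∀ h K : HSA.Poly, (HSA.IsDarbouxPolynomial α 0 κ lam h K ∧ K ≠ 0) ↔
      ∃ (c : ℂ) (n : ℕ), c ≠ 0 ∧ 1 ≤ n ∧ h = HSA.const c * HSA.x ^ n ∧
        K = HSA.const n * (HSA.y - 1)) ∧
    -- (c) the exponential factors are exactly `exp z`, with cofactor `x - lam z`, up to powers
    -- and constant multiples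
    (∀ g h L : HSA.Poly, HSA.IsExponentialFactor α 0 κ lam g h L ↔
      ∃ a c d : ℂ, a ≠ 0 ∧ c ≠ 0 ∧ h = HSA.const a ∧
        g = (HSA.const c * HSA.z + HSA.const d) * h ∧
        L = HSA.const c * (HSA.x - HSA.const lam * HSA.z)) ∧
    -- (d) it is not Darboux integrable
    ¬ HSA.IsDarbouxIntegrable α 0 κ lam := by
  have hακ' : α ≠ κ * (1 - κ) := fun h => hακ (by rw [h]; ring)
  refine ⟨HSA.not_hasPolynomialFirstIntegral hα hκ hακ', fun h K => ?_,
    HSA.isExponentialFactor_iff hα hκ hακ', HSA.not_isDarbouxIntegrable hα hκ hακ'⟩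
  rw [HSA.isDarbouxPolynomial_iff hα hκ hακ']
  refine and_iff_left_of_imp ?_
  rintro ⟨c, n, -, hn, -, rfl⟩
  exact HSA.const_mul_y_sub_one_ne_zero (by omega)
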